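/- Let $n\ge 1$, let $S^{n-1}$ be the unit sphere of $\mathbb R^n$, let $v_1,\dots,v_m\in S^{n-1}$ be distinct, let $u_1,\dots,u_k\in S^{n-1}$ be distinct, let $\mu_1,\dots,\mu_m$ be positive integers, and put $$\mu=\sum_{i=1}^m\mu_i\,\delta_{v_i},\qquad \lambda=\sum_{j=1}^k\delta_{u_j}.$$ Assume: (a) $\mu$ and $\lambda$ are weak Aleksandrov related: $\lambda(S^{n-1})=\mu(S^{n-1})\ge \mu(\omega)+\lambda(\omega^*)$ for every compact spherically convex $\omega\subset S^{n-1}$. Here $\omega$ is spherically convex if $\{tu: t\ge 0,\ u\in\omega\}$ is a nonempty convex subset of $\mathbb R^n$ different from $\mathbb R^n$, and $\omega^*=\bigcap_{u\in\omega}\{v\in S^{n-1}: u\cdot v\le 0\}$. (b) $\mu$ and $\lambda$ are edge-normal loop free: there are no $l$ with $2\le l\le m$, distinct indices $j_1,\dots,j_l\in\{1,\dots,k\}$, distinct indices $i_1,\dots,i_l\in\{1,\dots,m\}$ and points $x_s=t_sv_{i_s}$ with $t_s>0$ ($1\le s\le l$) such that $u_{j_s}\perp x_{s+1}-x_s$ for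 $1\le s\le l$, where $x_{l+1}=x_1$. (c) $\mu$ is not concentrated on a closed hemisphere: for every $e\in S^{n-1}$ there is an $i$ with $v_i\cdot e>0$. For a convex body $K\subset\mathbb R^n$ with the origin in its interior and $u\in S^{n-1}$, let $r_K(u)=\rho_K(u)u$, where $\rho_K(u)=\max\{a: au\in K\}$; let $N(K,x)=\{v\in S^{n-1}: (y-x)\cdot v\le 0 \text{ for all } y\in K\}$ for $x\in\partial K$; and let $$\lambda(K,\omega)=\lambda\Bigl(\bigcup_{x\in r_K(\omega)}N(K,x)\Bigr)\qquad\text{for Borel }\omega\subset S^{n-1}$$ be the Gauss image measure of $\lambda$ via $K$. Let $\mathcal P_\mu$ be the set of convex polytopes with the origin in their interior of the form $P=\bigl(\bigcap_{i=1}^m\{x: x\cdot v_i\le\alpha_i\}\bigr)^*$ with all $\alpha_i>0$, where $K^*=\{y: x\cdot y\le 1\text{ for all }x\in K\}$. Then there exists $P\in\mathcal P_\mu$ whose vertices are exactly the points $r_P(v_1),\dots,r_P(v_m)$ and for which $\lambda(P,\cdot)=\mu$, that is, $\lambda(P,\omega)=\mu(\omega)$ for every Borel set $\omega\subset S^{n-1}$.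 -/

import Mathlib

open MeasureTheory
open scoped ENNReal

noncomputable section

namespace GaussImage

/-- Euclidean space `ℝⁿ`. -/
abbrev E (n : ℕ) : Type := EuclideanSpace ℝ (Fin n)

/-- The unit sphere `S^{n-1}` of `ℝⁿ`, with its Borel σ-algebra. -/
abbrev S (n : ℕ) : Type := Metric.sphere (0 : E n) 1

/-! ### Convex bodies and the Gauss image -/

/-- Convex bodies in `ℝⁿ` that contain the origin in their interior. -/
def convexBodiesO (n : ℕ) : Set (Set (E n)) :=
  {K | IsCompact K ∧ Convex ℝ K ∧ (0 : E n) ∈ interior K}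

/-- Convex polytopes: convex hulls of finite sets of points. -/
def convexPolytopes (n : ℕ) : Set (Set (E n)) :=
  {P | ∃ F : Set (E n), F.Finite ∧ P = convexHull ℝ F}

/-- The radial function `ρ_K(u) = max {a : a u ∈ K}`. -/
def radialFunction {n : ℕ} (K : Set (E n)) (u : S n) : ℝ :=
  sSup {a : ℝ | a • (u : E n) ∈ K}

/-- The radial map `r_K(u) = ρ_K(u) u`. -/
def radialMap {n : ℕ} (K : Set (E n)) (u : S n) : E n :=
  radialFunction K u • (u : E n)

/-- The normal cone `N(K,x)`: all outer unit normals of `K` at `x`. -/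
def normalCone {n : ℕ} (K : Set (E n)) (x : E n) : Set (S n) :=
  {v | ∀ y ∈ K, inner ℝ (y - x) (v : E n) ≤ 0}

/-- The radial Gauss image of `ω`: the union of `N(K,x)` over `x ∈ r_K(ω)`. -/
def radialGaussImage {n : ℕ} (K : Set (E n)) (ω : Set (S n)) : Set (S n) :=
  ⋃ x ∈ radialMap K '' ω, normalCone K x

/-- The Gauss image measure `λ(K,·)` of `lam` via `K`, as a set function. -/
def gaussImageMeasure {n : ℕ} (lam : Measure (S n)) (K : Set (E n)) (ω : Set (S n)) : ℝ≥0∞ :=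
  lam (radialGaussImage K ω)

/-! ### Discrete measures -/

/-- The discrete measure `∑ i, w i • δ_{v i}`. -/
def discreteMeasure {n m : ℕ} (w : Fin m → ℝ≥0∞) (v : Fin m → S n) : Measure (S n) :=
  ∑ i, w i • Measure.dirac (v i)

/-- `mu` is concentrated on some closed hemisphere `{x ∈ S^{n-1} : x · e ≤ 0}`. -/
def ConcentratedOnClosedHemisphere {n : ℕ} (mu : Measure (S n)) : Prop :=
  ∃ e : S n, mu {x : S n | inner ℝ (x : E n) (e : E n) ≤ 0}ᶜ = 0

/-! ### The weak Aleksandrov relation -/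

/-- The cone `{t u : t ≥ 0, u ∈ ω}` generated by `ω`. -/
def coneOf {n : ℕ} (ω : Set (S n)) : Set (E n) :=
  {x | ∃ t : ℝ, 0 ≤ t ∧ ∃ u ∈ ω, x = t • (u : E n)}

/-- `ω` is spherically convex: its cone is a nonempty convex set other than `ℝⁿ`. -/
def SphericallyConvex {n : ℕ} (ω : Set (S n)) : Prop :=
  (coneOf ω).Nonempty ∧ Convex ℝ (coneOf ω) ∧ coneOf ω ≠ Set.univ

/-- The spherical polar set `ω^* = ⋂_{u ∈ ω} {v ∈ S^{n-1} : u · v ≤ 0}`. -/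
def polarSet {n : ℕ} (ω : Set (S n)) : Set (S n) :=
  ⋂ u ∈ ω, {v : S n | inner ℝ (u : E n) (v : E n) ≤ 0}

/-- `mu` and `lam` are weak Aleksandrov related. -/
def WeakAleksandrovRelated {n : ℕ} (mu lam : Measure (S n)) : Prop :=
  lam Set.univ = mu Set.univ ∧
    ∀ ω : Set (S n), IsCompact ω → SphericallyConvex ω →
      mu ω + lam (polarSet ω) ≤ mu Set.univ

/-! ### Edge-normal loops -/

/-- `x 0, …, x (l-1)` are the vertices of an edge-normal loop of the distinct vectors `u` and
the distinct vectors `v`: each `x i` is a positive multiple of `v i`, and `u i` is perpendicular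
to the segment from `x i` to the cyclically next vertex. -/
def IsEdgeNormalLoop {n l : ℕ} (u v : Fin l → S n) (x : Fin l → E n) : Prop :=
  2 ≤ l ∧ Function.Injective u ∧ Function.Injective v ∧
    (∀ i, ∃ t : ℝ, 0 < t ∧ x i = t • (v i : E n)) ∧
    ∀ i, inner ℝ (u i : E n) (x (finRotate l i) - x i) = 0

/-- No `l` of the `u`'s and `l` of the `v`'s, `2 ≤ l ≤ m`, in whatever order, have an
edge-normal loop. -/
def EdgeNormalLoopFree {n k m : ℕ} (u : Fin k → S n) (v : Fin m → S n) : Prop :=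
  ∀ l : ℕ, 2 ≤ l → l ≤ m → ∀ (a : Fin l → Fin k) (b : Fin l → Fin m),
    Function.Injective a → Function.Injective b →
      ¬ ∃ x : Fin l → E n, IsEdgeNormalLoop (u ∘ a) (v ∘ b) x

/-! ### The class of polytopes -/

/-- The half-space `H^-(α,v) = {x : x · v ≤ α}`. -/
def halfSpace {n : ℕ} (α : ℝ) (v : S n) : Set (E n) :=
  {x | inner ℝ x (v : E n) ≤ α}

/-- The polar body `K^* = {y : x · y ≤ 1 for all x ∈ K}`. -/
def polarBody {n : ℕ} (K : Set (E n)) : Set (E n) :=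
  {y | ∀ x ∈ K, inner ℝ x y ≤ 1}

/-- For a discrete measure `μ` with atoms `v i`, the class `P_μ` of convex polytopes with the
origin in their interior that have the form `(⋂ i, H^-(α i, v i))^*` with all `α i > 0`. -/
def polytopeClass {n m : ℕ} (v : Fin m → S n) : Set (Set (E n)) :=
  {P | P ∈ convexBodiesO n ∧ P ∈ convexPolytopes n ∧
    ∃ α : Fin m → ℝ, (∀ i, 0 < α i) ∧ P = polarBody (⋂ i, halfSpace (α i) (v i))}

end GaussImage

end

open MeasureTheory
open scoped ENNReal

namespace GaussImage

/-! ### Strict potentials on finite weighted digraphs -/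

/-! The problem is an assignment problem with multiplicative profit. Split each `v i` into `w i`
slots. The weak Aleksandrov relation is Hall's condition for matching every `u j` to a slot with
positive inner product (`exists_positive_assignment`). Among all matchings take one that maximizes
the product of the positive parts of the inner products. Equality of the profits before and after a
cyclic exchange would produce an edge-normal loop, so every cyclic exchange strictly lowers the
profit.

Strictness on cycles gives strict dual variables `t i > 0` (`exists_strict_potential`,
`exists_assignment_potential`): each `u j` has a unique maximizer among the points `t i • v i`,
namely the one it is matched to. Let `P` be the convex hull of these points. Every point is exposed
by some `u j`, hence is a vertex, and `u j` is normal to `P` only at its own vertex, so counting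
slots gives the Gauss image measure. The hemisphere condition puts the origin in the interior of `P`
and gives the polar form. -/

theorem exists_cycle_of_maps {V : Type*} [Finite V] (g : V → V) (A : Set V) (hA : A.Nonempty)
    (hmaps : Set.MapsTo g A A) (hne : ∀ x ∈ A, g x ≠ x) :
    ∃ l : ℕ, 2 ≤ l ∧ ∃ b : Fin l → V, Function.Injective b ∧ (∀ s, b s ∈ A) ∧
      ∀ s, b (finRotate l s) = g (b s) := by
  obtain ⟨x, hx⟩ := hA
  obtain ⟨i, j, hij, heq⟩ := Finite.exists_ne_map_eq_of_infinite (fun i : ℕ => g^[i] x)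
  wlog hlt : i < j generalizing i j
  · exact this j i hij.symm heq.symm (lt_of_le_of_ne (not_lt.mp hlt) hij.symm)
  -- The orbit of a periodic point over one minimal period is the cycle; its length is not 1 because
  -- `g` fixes no point of `A`.
  obtain ⟨y, hy⟩ : ∃ y, y = g^[i] x := ⟨_, rfl⟩
  have hyA : y ∈ A := hy ▸ hmaps.iterate i hx
  have hper : Function.IsPeriodicPt g (j - i) y := by
    change g^[j - i] y = y
    rw [hy, ← Function.iterate_add_apply, Nat.sub_add_cancel hlt.le]
    exact heq.symm
  have hpos : 0 < Function.minimalPeriod g y := hper.minimalPeriod_pos (Nat.sub_pos_of_lt hlt)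
  have hper' := Function.iterate_minimalPeriod (f := g) (x := y)
  have hinj := Function.iterate_injOn_Iio_minimalPeriod (f := g) (x := y)
  have hone : Function.minimalPeriod g y ≠ 1 := fun h => by
    rw [h] at hper'
    exact hne y hyA hper'
  generalize Function.minimalPeriod g y = l at *
  obtain ⟨l, rfl⟩ : ∃ l', l = l' + 1 := ⟨l - 1, by omega⟩
  refine ⟨l + 1, by omega, fun s => g^[(s : ℕ)] y, ?_, ?_, ?_⟩
  · intro s t hst
    exact Fin.ext (hinj s.2 t.2 hst)
  · intro s
    exact hmaps.iterate _ hyA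
  · intro s
    by_cases hs : s = Fin.last l
    · subst hs
      simpa [finRotate_last, Function.iterate_succ_apply'] using hper'.symm
    · simp only [coe_finRotate_of_ne_last hs, Function.iterate_succ_apply']

section Potential

variable {V : Type*} [Fintype V] [DecidableEq V]

/-- A minimizer of the largest violation of the constraints `τ b - τ a ≤ d a b`. -/
theorem exists_min_violation (d : V → V → ℝ) (hV : ∃ a b : V, a ≠ b) :
    ∃ (φ : ℝ) (τ : V → ℝ), (∀ a b, a ≠ b → τ b - τ a - d a b ≤ φ) ∧
      ∀ τ' : V → ℝ, ∃ a b, a ≠ b ∧ φ ≤ τ' b - τ' a - d a b := by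
  obtain ⟨a₀, b₀, hab⟩ := hV
  let P : Finset (V × V) := Finset.univ.filter fun p => p.1 ≠ p.2
  have hP : P.Nonempty := ⟨(a₀, b₀), by simpa [P] using hab⟩
  let F : (V → ℝ) → ℝ := fun τ => P.sup' hP fun p => τ p.2 - τ p.1 - d p.1 p.2
  have hF : Continuous F := by
    refine Continuous.finset_sup'_apply hP fun p _ => ?_
    fun_prop
  have hle : ∀ τ a b, a ≠ b → τ b - τ a - d a b ≤ F τ := fun τ a b h =>
    Finset.le_sup' (fun p : V × V => τ p.2 - τ p.1 - d p.1 p.2)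
      (show (a, b) ∈ P by simpa [P] using h)
  -- `F` is invariant under adding constants to `τ`; fixing `τ a₀ = 0` makes the sublevel set
  -- compact.
  let L : Set (V → ℝ) := {τ | τ a₀ = 0 ∧ F τ ≤ F 0}
  have hLc : IsClosed L :=
    (isClosed_eq (continuous_apply a₀) continuous_const).inter (isClosed_le hF continuous_const)
  have hLs : L ⊆ Set.Icc (fun a => -|F 0 + d a a₀|) (fun b => |F 0 + d a₀ b|) := by
    rintro τ ⟨h0, h1⟩
    refine ⟨fun a => ?_, fun a => ?_⟩
    · by_cases h : a = a₀
      · subst h; rw [h0]; simp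
      · have := hle τ a a₀ h
        have := le_abs_self (F 0 + d a a₀)
        change -|F 0 + d a a₀| ≤ τ a
        linarith
    · by_cases h : a = a₀
      · subst h; rw [h0]; positivity
      · have := hle τ a₀ a (Ne.symm h)
        have := le_abs_self (F 0 + d a₀ a)
        change τ a ≤ |F 0 + d a₀ a|
        linarith
  have hLk : IsCompact L := isCompact_Icc.of_isClosed_subset hLc hLs
  obtain ⟨τ, hτ, hmin⟩ := hLk.exists_isMinOn ⟨0, rfl, le_rfl⟩ hF.continuousOn
  refine ⟨F τ, τ, hle τ, fun τ' => ?_⟩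
  have hFF : F τ ≤ F τ' := by
    by_cases h : F τ' ≤ F 0
    · have hs : F (fun a => τ' a - τ' a₀) = F τ' := by
        simp only [F, sub_sub_sub_cancel_right]
      exact (isMinOn_iff.1 hmin (fun a => τ' a - τ' a₀)
        ⟨sub_self (τ' a₀), hs.le.trans h⟩).trans hs.le
    · exact hτ.2.trans (not_le.mp h).le
  obtain ⟨p, hp, hpe⟩ := Finset.exists_mem_eq_sup' hP fun p => τ' p.2 - τ' p.1 - d p.1 p.2
  exact ⟨p.1, p.2, by simpa [P] using hp, hFF.trans hpe.le⟩

/-- Suppose the least possible worst violation `φ` is nonnegative, and take a minimizer with the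
fewest tight pairs. If every endpoint of a tight pair starts another one, the tight pairs contain a
cycle, and summing `d` along it gives `-l * φ ≤ 0`. Otherwise the potential can be lowered at an
endpoint without outgoing tight pair, which leaves fewer tight pairs. -/
theorem exists_strict_potential (d : V → V → ℝ)
    (hcyc : ∀ l : ℕ, 2 ≤ l → ∀ b : Fin l → V, Function.Injective b →
      0 < ∑ s, d (b s) (b (finRotate l s))) :
    ∃ τ : V → ℝ, ∀ a b, a ≠ b → τ b - τ a < d a b := by
  by_cases hV : ∃ a b : V, a ≠ b
  swap
  · push Not at hV
    exact ⟨0, fun a b h => absurd (hV a b) h⟩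
  obtain ⟨φ, τ₀, hτ₀, hφ⟩ := exists_min_violation d hV
  rcases lt_or_ge φ 0 with hneg | hnn
  · exact ⟨τ₀, fun a b h => by linarith [hτ₀ a b h]⟩
  exfalso
  let T : (V → ℝ) → Finset (V × V) := fun τ =>
    Finset.univ.filter fun p => p.1 ≠ p.2 ∧ τ p.2 - τ p.1 - d p.1 p.2 = φ
  have hT : ∀ τ p, p ∈ T τ ↔ p.1 ≠ p.2 ∧ τ p.2 - τ p.1 - d p.1 p.2 = φ := by simp [T]
  obtain ⟨τ, hτ, hmin⟩ : ∃ τ : V → ℝ, (∀ a b, a ≠ b → τ b - τ a - d a b ≤ φ) ∧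
      ∀ τ' : V → ℝ, (∀ a b, a ≠ b → τ' b - τ' a - d a b ≤ φ) → (T τ).card ≤ (T τ').card := by
    have hex : ∃ N, ∃ τ : V → ℝ, (∀ a b, a ≠ b → τ b - τ a - d a b ≤ φ) ∧ (T τ).card = N :=
      ⟨_, τ₀, hτ₀, rfl⟩
    classical
    obtain ⟨τ, h1, h2⟩ := Nat.find_spec hex
    exact ⟨τ, h1, fun τ' h' => h2 ▸ Nat.find_min' hex ⟨τ', h', rfl⟩⟩
  obtain ⟨a₁, b₁, hab₁, hge⟩ := hφ τ
  have htight : (a₁, b₁) ∈ T τ := (hT _ _).2 ⟨hab₁, le_antisymm (hτ _ _ hab₁) hge⟩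
  by_cases hout : ∀ b, (∃ a, (a, b) ∈ T τ) → ∃ c, (b, c) ∈ T τ
  · choose! g hg using hout
    obtain ⟨l, hl, b, hbi, hbA, hb⟩ := exists_cycle_of_maps g {b | ∃ a, (a, b) ∈ T τ}
      ⟨b₁, a₁, htight⟩ (fun x hx => ⟨x, hg x hx⟩)
      (fun x hx h => ((hT _ _).1 (hg x hx)).1 h.symm)
    have hd : ∀ s, d (b s) (b (finRotate l s)) = τ (b (finRotate l s)) - τ (b s) - φ := by
      intro s
      have := ((hT _ _).1 (hg _ (hbA s))).2
      rw [hb]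
      simp only at this
      linarith
    have hpos := hcyc l hl b hbi
    simp only [hd, Finset.sum_sub_distrib] at hpos
    rw [Equiv.sum_comp (finRotate l) (fun s => τ (b s))] at hpos
    simp only [sub_self, zero_sub, Finset.sum_const, Finset.card_univ, Fintype.card_fin,
      nsmul_eq_mul] at hpos
    have : 0 ≤ (l : ℝ) * φ := by positivity
    linarith
  · push Not at hout
    obtain ⟨b, ⟨a, hab⟩, hbout⟩ := hout
    have hlt : ∀ c, b ≠ c → τ c - τ b - d b c < φ := fun c hc =>
      lt_of_le_of_ne (hτ b c hc) fun h => hbout c ((hT _ _).2 ⟨hc, h⟩)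
    obtain ⟨ε, hε, hsmall⟩ : ∃ ε : ℝ, 0 < ε ∧ ∀ c, b ≠ c → τ c - τ b - d b c + ε < φ := by
      have hev : ∀ᶠ ε in nhdsWithin (0 : ℝ) (Set.Ioi 0), ∀ c, b ≠ c →
          τ c - τ b - d b c + ε < φ := by
        refine Filter.eventually_all.2 fun c => ?_
        by_cases hc : b = c
        · exact Filter.Eventually.of_forall fun _ h => absurd hc h
        · have : Filter.Tendsto (fun ε : ℝ => τ c - τ b - d b c + ε) (nhdsWithin 0 (Set.Ioi 0))
              (nhds (τ c - τ b - d b c + 0)) :=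
            ((continuous_const.add continuous_id).tendsto 0).mono_left nhdsWithin_le_nhds
          filter_upwards [this.eventually (gt_mem_nhds (by simpa using hlt c hc))] with ε h _
          exact h
      obtain ⟨ε, h1, h2⟩ := (hev.and self_mem_nhdsWithin).exists
      exact ⟨ε, h2, h1⟩
    -- Pairs into `b` gain slack `ε`; pairs out of `b` lose only `ε` and stay below `φ`.
    let τ' : V → ℝ := Function.update τ b (τ b - ε)
    have hb' : τ' b = τ b - ε := Function.update_self ..
    have hne' : ∀ c, c ≠ b → τ' c = τ c := fun c hc => Function.update_of_ne hc ..
    have hcase : ∀ x y, x ≠ y → τ' y - τ' x - d x y ≤ φ ∧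
        (τ' y - τ' x - d x y = φ → (x, y) ∈ T τ ∧ y ≠ b) := by
      intro x y hxy
      by_cases hx : x = b
      · subst hx
        rw [hb', hne' y hxy.symm]
        have := hsmall y hxy
        exact ⟨by linarith, fun h => by linarith⟩
      · by_cases hy : y = b
        · subst hy
          rw [hb', hne' x hx]
          have := hτ x y hxy
          exact ⟨by linarith, fun h => by linarith⟩
        · rw [hne' x hx, hne' y hy]
          exact ⟨hτ x y hxy, fun h => ⟨(hT _ _).2 ⟨hxy, h⟩, hy⟩⟩
    have hss : T τ' ⊂ T τ := by
      refine (Finset.ssubset_iff_of_subset fun p hp => ?_).2 ⟨(a, b), hab, fun h => ?_⟩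
      · obtain ⟨h1, h2⟩ := (hT _ _).1 hp
        exact ((hcase p.1 p.2 h1).2 h2).1
      · obtain ⟨h1, h2⟩ := (hT _ _).1 h
        exact ((hcase a b h1).2 h2).2 rfl
    exact absurd (hmin τ' fun x y h => (hcase x y h).1) (not_le.2 (Finset.card_lt_card hss))

/-- Multiplicative form, with vanishing weights allowed. -/
theorem exists_pos_potential (r : V → V → ℝ) (hr : ∀ a b, 0 ≤ r a b)
    (hcyc : ∀ l : ℕ, 2 ≤ l → ∀ b : Fin l → V, Function.Injective b →
      ∏ s, r (b s) (b (finRotate l s)) < 1) :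
    ∃ t : V → ℝ, (∀ a, 0 < t a) ∧ ∀ a b, a ≠ b → r a b * t b < t a := by
  -- Adding `ε` makes all weights positive, so logarithms apply. Injective cycles are finitely many,
  -- so the strict inequalities survive a small `ε`.
  obtain ⟨ε, hε, hε1⟩ : ∃ ε : ℝ, 0 < ε ∧ ∀ l : Fin (Fintype.card V + 1), ∀ b : Fin l → V,
      2 ≤ (l : ℕ) → Function.Injective b →
        ∏ s, (r (b s) (b (finRotate l s)) + ε) < 1 := by
    have hev : ∀ᶠ ε in nhdsWithin (0 : ℝ) (Set.Ioi 0), ∀ l : Fin (Fintype.card V + 1),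
        ∀ b : Fin l → V, 2 ≤ (l : ℕ) → Function.Injective b →
          ∏ s, (r (b s) (b (finRotate l s)) + ε) < 1 := by
      refine Filter.eventually_all.2 fun l => Filter.eventually_all.2 fun b => ?_
      by_cases h : 2 ≤ (l : ℕ) ∧ Function.Injective b
      · have hc : Continuous fun ε : ℝ => ∏ s, (r (b s) (b (finRotate l s)) + ε) := by fun_prop
        have ht := (hc.tendsto 0).mono_left (nhdsWithin_le_nhds (s := Set.Ioi 0))
        filter_upwards [ht.eventually (gt_mem_nhds (by simpa using hcyc l h.1 b h.2))]
          with ε h' _ _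
        exact h'
      · exact Filter.Eventually.of_forall fun _ h1 h2 => absurd ⟨h1, h2⟩ h
    obtain ⟨ε, h1, h2⟩ := (hev.and self_mem_nhdsWithin).exists
    exact ⟨ε, h2, h1⟩
  have hpos : ∀ a b, 0 < r a b + ε := fun a b => by linarith [hr a b]
  obtain ⟨τ, hτ⟩ := exists_strict_potential (fun a b => -Real.log (r a b + ε)) (by
    intro l hl b hb
    have hlV : l ≤ Fintype.card V := by simpa using Fintype.card_le_of_injective b hb
    have := hε1 ⟨l, by omega⟩ b hl hb
    rw [Finset.sum_neg_distrib, ← Real.log_prod (fun s _ => (hpos _ _).ne')]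
    exact neg_pos.2 (Real.log_neg (Finset.prod_pos fun s _ => hpos _ _) this))
  refine ⟨fun a => Real.exp (τ a), fun a => Real.exp_pos _, fun a b hab => ?_⟩
  calc r a b * Real.exp (τ b) < (r a b + ε) * Real.exp (τ b) :=
        mul_lt_mul_of_pos_right (by linarith) (Real.exp_pos _)
    _ = Real.exp (Real.log (r a b + ε) + τ b) := by rw [Real.exp_add, Real.exp_log (hpos a b)]
    _ < Real.exp (τ a) := Real.exp_lt_exp.2 (by linarith [hτ a b hab])

end Potential

/-! ### Optimal assignments and cyclic exchanges -/

/-- Dual variables of an optimal assignment without ties. -/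
theorem exists_assignment_potential {J V : Type*} [Fintype J] [DecidableEq J] [Fintype V]
    [DecidableEq V] (p : J → V → ℝ) (hp : ∀ j i, 0 ≤ p j i) (f : J → V)
    (hf : Function.Surjective f) (hpf : ∀ j, 0 < p j (f j))
    (hopt : ∀ σ : Equiv.Perm J, ∏ j, p j (f (σ j)) ≤ ∏ j, p j (f j))
    (htie : ∀ l : ℕ, 2 ≤ l → ∀ a : Fin l → J, Function.Injective (f ∘ a) →
      ∏ s, p (a s) (f (a (finRotate l s))) ≠ ∏ s, p (a s) (f (a s))) :
    ∃ t : V → ℝ, (∀ i, 0 < t i) ∧ ∀ j i, i ≠ f j → p j i * t i < p j (f j) * t (f j) := by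
  let fib : V → Finset J := fun i => Finset.univ.filter fun j => f j = i
  have hfib : ∀ i, (fib i).Nonempty := fun i => by
    obtain ⟨j, hj⟩ := hf i
    exact ⟨j, by simp [fib, hj]⟩
  -- The best factor gained by moving some `j` from `i` to `i'`; the goal becomes `r i i' * t i' < t
  -- i`.
  let r : V → V → ℝ := fun i i' => (fib i).sup' (hfib i) fun j => p j i' / p j (f j)
  have hmax : ∀ i i', ∃ j, f j = i ∧ r i i' = p j i' / p j (f j) := fun i i' => by
    obtain ⟨j, hj, he⟩ := Finset.exists_mem_eq_sup' (hfib i) fun j => p j i' / p j (f j)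
    exact ⟨j, by simpa [fib] using hj, he⟩
  obtain ⟨t, ht, hrt⟩ := exists_pos_potential r (fun i i' => by
      obtain ⟨j, _, he⟩ := hmax i i'
      rw [he]
      exact div_nonneg (hp _ _) (hp _ _)) (by
    intro l hl b hb
    choose a hab har using fun s => hmax (b s) (b (finRotate l s))
    have hfa : f ∘ a = b := funext hab
    have hainj : Function.Injective a := Function.Injective.of_comp (f := f) (hfa ▸ hb)
    have hle : ∏ s, p (a s) (f (a (finRotate l s))) ≤ ∏ s, p (a s) (f (a s)) := by
      -- A cycle of `r` is realized by distinct elements `a s`; rotating them and fixing all others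
      -- gives a competing assignment.
      let σ : Equiv.Perm J := (finRotate l).viaFintypeEmbedding ⟨a, hainj⟩
      have hσa : ∀ s, σ (a s) = a (finRotate l s) := fun s =>
        Equiv.Perm.viaFintypeEmbedding_apply_image (finRotate l) ⟨a, hainj⟩ s
      have hσn : ∀ j, j ∉ Finset.univ.image a → σ j = j := fun j hj =>
        Equiv.Perm.viaFintypeEmbedding_apply_notMem_range (finRotate l) ⟨a, hainj⟩
          (by simpa using hj)
      have h := hopt σ
      rw [← Finset.prod_mul_prod_compl (Finset.univ.image a),
        ← Finset.prod_mul_prod_compl (Finset.univ.image a) (fun j => p j (f j)),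
        Finset.prod_image hainj.injOn, Finset.prod_image hainj.injOn,
        Finset.prod_congr rfl (s₁ := (Finset.univ.image a)ᶜ) (g := fun j => p j (f j))
          (fun j hj => by rw [hσn j (Finset.mem_compl.1 hj)])] at h
      simp only [hσa] at h
      exact le_of_mul_le_mul_right h (Finset.prod_pos fun j _ => hpf j)
    have hlt := lt_of_le_of_ne hle (htie l hl a (hfa ▸ hb))
    have heq : ∏ s, r (b s) (b (finRotate l s)) =
        (∏ s, p (a s) (f (a (finRotate l s)))) / ∏ s, p (a s) (f (a s)) := by
      rw [← Finset.prod_div_distrib]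
      exact Finset.prod_congr rfl fun s _ => by rw [har, hab (finRotate l s)]
    rw [heq]
    exact (div_lt_one (Finset.prod_pos fun s _ => hpf _)).2 hlt)
  refine ⟨t, ht, fun j i hij => ?_⟩
  have h1 : p j i / p j (f j) ≤ r (f j) i :=
    Finset.le_sup' (fun j' => p j' i / p j' (f j')) (show j ∈ fib (f j) by simp [fib])
  have h2 := (mul_le_mul_of_nonneg_right h1 (ht i).le).trans_lt (hrt (f j) i hij.symm)
  rw [div_mul_eq_mul_div, div_lt_iff₀ (hpf j)] at h2
  linarith

/-- Take partial products of `ρ`; they close up around the cycle because the full product is 1. -/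
theorem exists_cyclic_scaling {l : ℕ} (ρ : Fin l → ℝ) (hρ : ∀ s, 0 < ρ s) (hprod : ∏ s, ρ s = 1) :
    ∃ t : Fin l → ℝ, (∀ s, 0 < t s) ∧ ∀ s, t (finRotate l s) = t s * ρ s := by
  rcases l with _ | l
  · exact ⟨fun _ => 1, fun _ => one_pos, fun s => s.elim0⟩
  let R : ℕ → ℝ := fun i => if h : i < l + 1 then ρ ⟨i, h⟩ else 1
  have hR : ∀ s : Fin (l + 1), R s = ρ s := fun s => dif_pos s.2
  have hR0 : ∀ i, 0 < R i := fun i => by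
    unfold R
    split_ifs
    exacts [hρ _, one_pos]
  refine ⟨fun s => ∏ i ∈ Finset.range s, R i, fun s => Finset.prod_pos fun i _ => hR0 i,
    fun s => ?_⟩
  by_cases hs : s = Fin.last l
  · subst hs
    rw [← hR (Fin.last l)]
    simp only [finRotate_last, Fin.val_zero, Finset.range_zero, Finset.prod_empty, Fin.val_last]
    rw [← Finset.prod_range_succ, Finset.prod_range]
    simp only [hR, hprod]
  · beta_reduce
    rw [coe_finRotate_of_ne_last hs, Finset.prod_range_succ, hR]

/-! ### The weak Aleksandrov relation as a marriage condition -/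

theorem discreteMeasure_apply {n m : ℕ} (w : Fin m → ℝ≥0∞) (v : Fin m → S n) (ω : Set (S n)) :
    discreteMeasure w v ω = ∑ i, w i * ω.indicator 1 (v i) := by
  simp [discreteMeasure, Measure.dirac_apply]

theorem norm_sphere {n : ℕ} (v : S n) : ‖(v : E n)‖ = 1 := by simp

theorem inner_sphere_self {n : ℕ} (v : S n) : inner ℝ (v : E n) (v : E n) = 1 := by
  rw [real_inner_self_eq_norm_sq, norm_sphere, one_pow]

/-- If some unit vector is polar to the nonempty set `A`, then `A` lies in a compact spherically
convex set with the same polar set. -/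
theorem exists_sphericallyConvex {n : ℕ} (A : Set (S n)) (hA : A.Nonempty)
    (hpol : (polarSet A).Nonempty) :
    ∃ ω, IsCompact ω ∧ SphericallyConvex ω ∧ A ⊆ ω ∧ polarSet A ⊆ polarSet ω := by
  -- The spherical bipolar of `A`: its cone is an intersection of closed half-spaces, proper because
  -- a polar vector `y` has `y · y = 1`.
  let ω : Set (S n) := ⋂ y ∈ polarSet A, {x : S n | inner ℝ (x : E n) (y : E n) ≤ 0}
  have hmem : ∀ x : S n, x ∈ ω ↔ ∀ y ∈ polarSet A, inner ℝ (x : E n) (y : E n) ≤ 0 := by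
    simp [ω]
  have hsub : A ⊆ ω := fun x hx => (hmem x).2 fun y hy => by
    simp only [polarSet, Set.mem_iInter] at hy
    exact hy x hx
  have hcone : coneOf ω = {x : E n | ∀ y ∈ polarSet A, inner ℝ x (y : E n) ≤ 0} := by
    ext x
    constructor
    · rintro ⟨t, ht, a, ha, rfl⟩ y hy
      rw [real_inner_smul_left]
      exact mul_nonpos_of_nonneg_of_nonpos ht ((hmem a).1 ha y hy)
    · intro hx
      by_cases h0 : x = 0
      · obtain ⟨a, ha⟩ := hA
        exact ⟨0, le_rfl, a, hsub ha, by simp [h0]⟩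
      · have hn : 0 < ‖x‖ := norm_pos_iff.2 h0
        refine ⟨‖x‖, hn.le, ⟨‖x‖⁻¹ • x, by simp [norm_smul, hn.ne']⟩, (hmem _).2 fun y hy => ?_, ?_⟩
        · change inner ℝ (‖x‖⁻¹ • x) (y : E n) ≤ 0
          rw [real_inner_smul_left]
          exact mul_nonpos_of_nonneg_of_nonpos (by positivity) (hx y hy)
        · simp [smul_smul, hn.ne']
  refine ⟨ω, ?_, ⟨?_, ?_, ?_⟩, hsub, ?_⟩
  · refine IsClosed.isCompact (isClosed_biInter fun y _ => isClosed_le ?_ continuous_const)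
    fun_prop
  · obtain ⟨a, ha⟩ := hA
    exact ⟨0, 0, le_rfl, a, hsub ha, by simp⟩
  · rw [hcone]
    intro x hx z hz a b ha hb _ y hy
    rw [inner_add_left, real_inner_smul_left, real_inner_smul_left]
    exact add_nonpos (mul_nonpos_of_nonneg_of_nonpos ha (hx y hy))
      (mul_nonpos_of_nonneg_of_nonpos hb (hz y hy))
  · obtain ⟨y, hy⟩ := hpol
    intro h
    have : (y : E n) ∈ coneOf ω := h ▸ Set.mem_univ _
    rw [hcone] at this
    have := this y hy
    rw [inner_sphere_self] at this
    linarith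
  · intro y hy
    simp only [polarSet, Set.mem_iInter]
    exact fun x hx => (hmem x).1 hx y hy

theorem sum_weights_eq {n m k : ℕ} (v : Fin m → S n) (w : Fin m → ℕ) (u : Fin k → S n)
    (hrel : WeakAleksandrovRelated (discreteMeasure (fun i => (w i : ℝ≥0∞)) v)
      (discreteMeasure (fun _ => 1) u)) : ∑ i, w i = k := by
  have h := hrel.1
  simp only [discreteMeasure_apply, Set.indicator_univ, Pi.one_apply, mul_one, Finset.sum_const,
    Finset.card_univ, Fintype.card_fin, nsmul_eq_mul] at h
  exact_mod_cast h.symm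

-- Hall's condition. The `u j` in `B`, with no positive inner product against `I`, lie in the polar
-- set of a spherically convex set containing all `v i`, `i ∈ I`; the relation then bounds the
-- weight of `I` plus the size of `B` by `k`.
open Classical in
theorem sum_weights_le_card {n m k : ℕ} (v : Fin m → S n) (w : Fin m → ℕ) (u : Fin k → S n)
    (hrel : WeakAleksandrovRelated (discreteMeasure (fun i => (w i : ℝ≥0∞)) v)
      (discreteMeasure (fun _ => 1) u))
    (I : Finset (Fin m)) :
    ∑ i ∈ I, w i ≤
      (Finset.univ.filter fun j => ∃ i ∈ I, 0 < inner ℝ (u j : E n) (v i : E n)).card := by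
  have hk := sum_weights_eq v w u hrel
  let B : Finset (Fin k) :=
    Finset.univ.filter fun j => ¬ ∃ i ∈ I, 0 < inner ℝ (u j : E n) (v i : E n)
  have hcard : (Finset.univ.filter fun j => ∃ i ∈ I, 0 < inner ℝ (u j : E n) (v i : E n)).card +
      B.card = k :=
    (Finset.card_filter_add_card_filter_not _).trans (by simp)
  have hIk : ∑ i ∈ I, w i ≤ k := hk ▸ Finset.sum_le_univ_sum_of_nonneg fun _ => Nat.zero_le _
  suffices ∑ i ∈ I, w i + B.card ≤ k by omega
  rcases I.eq_empty_or_nonempty with rfl | hI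
  · simpa using Finset.card_le_univ B
  rcases B.eq_empty_or_nonempty with hB | ⟨j₀, hj₀⟩
  · simpa [hB] using hIk
  have hBpol : ∀ j ∈ B, u j ∈ polarSet (v '' I) := by
    intro j hj
    simp only [B, Finset.mem_filter, Finset.mem_univ, true_and, not_exists, not_and, not_lt] at hj
    simp only [polarSet, Set.mem_iInter]
    rintro _ ⟨i, hi, rfl⟩
    change inner ℝ (v i : E n) (u j : E n) ≤ 0
    rw [real_inner_comm]
    exact hj i hi
  obtain ⟨ω, hωc, hωs, hsub, hpol⟩ := exists_sphericallyConvex (v '' (I : Set (Fin m)))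
    (hI.to_set.image v) ⟨_, hBpol j₀ hj₀⟩
  have h := hrel.2 ω hωc hωs
  rw [← hrel.1] at h
  simp only [discreteMeasure_apply, Set.indicator_univ, Pi.one_apply, mul_one, Finset.sum_const,
    Finset.card_univ, Fintype.card_fin, nsmul_eq_mul, one_mul] at h
  have h1 : ((∑ i ∈ I, w i : ℕ) : ℝ≥0∞) ≤ ∑ i, (w i : ℝ≥0∞) * ω.indicator 1 (v i) := by
    rw [Nat.cast_sum]
    refine le_trans (Finset.sum_le_sum fun i hi => ?_)
      (Finset.sum_le_sum_of_subset (Finset.subset_univ I))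
    rw [Set.indicator_of_mem (hsub ⟨i, hi, rfl⟩), Pi.one_apply, mul_one]
  have h2 : (B.card : ℝ≥0∞) ≤ ∑ j, (polarSet ω).indicator 1 (u j) := by
    rw [Finset.card_eq_sum_ones, Nat.cast_sum]
    refine le_trans (Finset.sum_le_sum fun j hj => ?_)
      (Finset.sum_le_sum_of_subset (Finset.subset_univ B))
    rw [Set.indicator_of_mem (hpol (hBpol j hj)), Pi.one_apply, Nat.cast_one]
  exact_mod_cast (add_le_add h1 h2).trans h

/-- By Hall's theorem there is an assignment, with `w i` of the `u j` assigned to `v i`, all of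
whose pairs have positive inner product. -/
theorem exists_positive_assignment {n m k : ℕ} (v : Fin m → S n) (w : Fin m → ℕ) (u : Fin k → S n)
    (hrel : WeakAleksandrovRelated (discreteMeasure (fun i => (w i : ℝ≥0∞)) v)
      (discreteMeasure (fun _ => 1) u)) :
    ∃ e : Fin k ≃ Σ i, Fin (w i), ∀ j, 0 < inner ℝ (u j : E n) (v (e j).1 : E n) := by
  classical
  let t : (Σ i, Fin (w i)) → Finset (Fin k) := fun p =>
    Finset.univ.filter fun j => 0 < inner ℝ (u j : E n) (v p.1 : E n)
  obtain ⟨g, hg, hgt⟩ := (Finset.all_card_le_biUnion_card_iff_exists_injective t).1 fun s => by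
    -- Acceptable `u j` depend only on the first component of a slot, so `s` may be enlarged to full
    -- fibres.
    calc s.card ≤ ((s.image Sigma.fst).sigma fun _ => Finset.univ).card :=
          Finset.card_le_card fun p hp => by
            simpa using ⟨p.2, hp⟩
      _ = ∑ i ∈ s.image Sigma.fst, w i := by simp [Finset.card_sigma]
      _ ≤ _ := sum_weights_le_card v w u hrel _
      _ ≤ (s.biUnion t).card := Finset.card_le_card fun j hj => by
            simp only [Finset.mem_filter, Finset.mem_univ, true_and, Finset.mem_image] at hj
            obtain ⟨_, ⟨p, hp, rfl⟩, hpos⟩ := hj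
            exact Finset.mem_biUnion.2 ⟨p, hp, by simpa [t] using hpos⟩
  have hbij : Function.Bijective g := (Fintype.bijective_iff_injective_and_card g).2
    ⟨hg, by simpa using sum_weights_eq v w u hrel⟩
  refine ⟨(Equiv.ofBijective g hbij).symm, fun j => ?_⟩
  have h := hgt ((Equiv.ofBijective g hbij).symm j)
  rw [show g _ = j from (Equiv.ofBijective g hbij).apply_symm_apply j] at h
  simpa [t] using h

/-- Vertices on the rays of the `v i` such that every `u j` has a unique maximizer among them,
with `w i` of the `u j` maximized at the `i`-th one. -/
theorem exists_strict_assignment {n m k : ℕ} (v : Fin m → S n) (w : Fin m → ℕ) (u : Fin k → S n)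
    (hw : ∀ i, 0 < w i)
    (hrel : WeakAleksandrovRelated (discreteMeasure (fun i => (w i : ℝ≥0∞)) v)
      (discreteMeasure (fun _ => 1) u))
    (hv : Function.Injective v) (hu : Function.Injective u) (hloop : EdgeNormalLoopFree u v) :
    ∃ (e : Fin k ≃ Σ i, Fin (w i)) (t : Fin m → ℝ), (∀ i, 0 < t i) ∧
      (∀ j, 0 < inner ℝ (u j : E n) (v (e j).1 : E n)) ∧
      ∀ j i, i ≠ (e j).1 →
        inner ℝ (u j : E n) (t i • (v i : E n)) <
          inner ℝ (u j : E n) (t (e j).1 • (v (e j).1 : E n)) := by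
  classical
  obtain ⟨e₀, he₀⟩ := exists_positive_assignment v w u hrel
  -- Truncation at 0 makes a product positive exactly when all its inner products are, so an optimal
  -- assignment uses only positive pairs.
  let p : Fin k → Fin m → ℝ := fun j i => max (inner ℝ (u j : E n) (v i : E n)) 0
  have hp : ∀ j i, 0 ≤ p j i := fun j i => le_max_right _ _
  have hp_pos : ∀ j i, 0 < p j i ↔ 0 < inner ℝ (u j : E n) (v i : E n) := by simp [p]
  have hp_eq : ∀ j i, 0 < p j i → p j i = inner ℝ (u j : E n) (v i : E n) := fun j i h =>
    max_eq_left ((hp_pos j i).1 h).le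
  obtain ⟨e, -, he⟩ := Finset.exists_max_image (Finset.univ : Finset (Fin k ≃ Σ i, Fin (w i)))
    (fun e => ∏ j, p j (e j).1) ⟨e₀, Finset.mem_univ _⟩
  have hprod : 0 < ∏ j, p j (e j).1 :=
    (Finset.prod_pos fun j _ => (hp_pos _ _).2 (he₀ j)).trans_le (he e₀ (Finset.mem_univ _))
  have hpe : ∀ j, 0 < p j (e j).1 := fun j =>
    lt_of_le_of_ne (hp _ _) fun h => hprod.ne' (Finset.prod_eq_zero (Finset.mem_univ j) h.symm)
  obtain ⟨t, ht, hlt⟩ := exists_assignment_potential p hp (fun j => (e j).1)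
    (fun i => ⟨e.symm ⟨i, ⟨0, hw i⟩⟩, by simp⟩) hpe (fun σ => he (σ.trans e) (Finset.mem_univ _)) (by
      intro l hl a hinj heq
      have hpa : 0 < ∏ s, p (a s) (e (a s)).1 := Finset.prod_pos fun s _ => hpe _
      have hq : ∀ s, 0 < p (a s) (e (a (finRotate l s))).1 := fun s =>
        lt_of_le_of_ne (hp _ _) fun h => hpa.ne' (heq ▸
          Finset.prod_eq_zero (Finset.mem_univ s) h.symm)
      -- A tie closes the recursion `c (s+1) * p (a s) (next) = c s * p (a s) (own)`, which says
      -- that `u (a s)` is perpendicular to the edge from point `s` to the next.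
      obtain ⟨c, hc, hrot⟩ := exists_cyclic_scaling
        (fun s => p (a s) (e (a s)).1 / p (a s) (e (a (finRotate l s))).1)
        (fun s => div_pos (hpe _) (hq s))
        (by rw [Finset.prod_div_distrib, heq, div_self hpa.ne'])
      have hlm : l ≤ m := by simpa using Fintype.card_le_of_injective _ hinj
      have hainj : Function.Injective a := Function.Injective.of_comp hinj
      refine hloop l hl hlm a (fun s => (e (a s)).1) hainj hinj
        ⟨fun s => c s • (v (e (a s)).1 : E n), hl, hu.comp hainj, hv.comp hinj,
          fun s => ⟨c s, hc s, rfl⟩, fun s => ?_⟩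
      rw [inner_sub_right, real_inner_smul_right, real_inner_smul_right, hrot s]
      simp only [Function.comp_apply]
      rw [← hp_eq _ _ (hq s), ← hp_eq _ _ (hpe (a s)), mul_assoc, div_mul_cancel₀ _ (hq s).ne',
        sub_self])
  refine ⟨e, t, ht, fun j => (hp_pos _ _).1 (hpe j), fun j i hij => ?_⟩
  rw [real_inner_smul_right, real_inner_smul_right, ← hp_eq _ _ (hpe j), mul_comm,
    mul_comm (t (e j).1)]
  exact (mul_le_mul_of_nonneg_right (le_max_left _ _) (ht i).le).trans_lt (hlt j i hij)

/-! ### Polytopes with vertices on prescribed rays -/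

theorem exists_inner_pos {n m : ℕ} (v : Fin m → S n) (w : Fin m → ℝ≥0∞)
    (h : ¬ ConcentratedOnClosedHemisphere (discreteMeasure w v)) {e : E n} (he : e ≠ 0) :
    ∃ i, 0 < inner ℝ (v i : E n) e := by
  by_contra! hle
  have hn : 0 < ‖e‖ := norm_pos_iff.2 he
  refine h ⟨⟨‖e‖⁻¹ • e, by simp [norm_smul, hn.ne']⟩, ?_⟩
  rw [discreteMeasure_apply]
  refine Finset.sum_eq_zero fun i _ => ?_
  rw [Set.indicator_of_notMem, mul_zero]
  rw [Set.notMem_compl_iff]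
  change inner ℝ (v i : E n) (‖e‖⁻¹ • e) ≤ 0
  rw [real_inner_smul_right]
  exact mul_nonpos_of_nonneg_of_nonpos (by positivity) (hle i)

/-- A linear functional on a convex hull is maximized only at its unique maximizer among the
generators. -/
theorem eq_or_inner_lt_of_mem_convexHull {n : ℕ} {ι : Type*} (x : ι → E n) (u : E n) (i₀ : ι)
    (h : ∀ i, i ≠ i₀ → inner ℝ u (x i) < inner ℝ u (x i₀)) {y : E n}
    (hy : y ∈ convexHull ℝ (Set.range x)) : y = x i₀ ∨ inner ℝ u y < inner ℝ u (x i₀) := by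
  refine convexHull_min (t := {y | y = x i₀ ∨ inner ℝ u y < inner ℝ u (x i₀)}) ?_ ?_ hy
  · rintro _ ⟨i, rfl⟩
    by_cases hi : i = i₀
    · exact Or.inl (hi ▸ rfl)
    · exact Or.inr (h i hi)
  · refine convex_iff_forall_pos.2 fun y hy z hz a b ha hb hab => ?_
    have hle : ∀ y, (y = x i₀ ∨ inner ℝ u y < inner ℝ u (x i₀)) →
        inner ℝ u y ≤ inner ℝ u (x i₀) := by
      rintro y (rfl | hy)
      exacts [le_rfl, hy.le]
    have hy' := hle y hy
    have hz' := hle z hz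
    have hsum : inner ℝ u (x i₀) = a * inner ℝ u (x i₀) + b * inner ℝ u (x i₀) := by
      rw [← add_mul, hab, one_mul]
    rcases hy with rfl | hy
    · rcases hz with rfl | hz
      · exact Or.inl (by rw [← add_smul, hab, one_smul])
      · right
        rw [inner_add_right, real_inner_smul_right, real_inner_smul_right]
        have := mul_lt_mul_of_pos_left hz hb
        linarith
    · right
      rw [inner_add_right, real_inner_smul_right, real_inner_smul_right]
      have := mul_lt_mul_of_pos_left hy ha
      have := mul_le_mul_of_nonneg_left hz' hb.le
      linarith

/-- The bipolar theorem for finitely many points, proved by separation. -/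
theorem convexHull_eq_polarBody {n m : ℕ} [Nonempty (Fin m)] (v : Fin m → S n) (t : Fin m → ℝ)
    (ht : ∀ i, 0 < t i)
    (hv : ∀ e : E n, e ≠ 0 → ∃ i, 0 < inner ℝ (v i : E n) e) :
    convexHull ℝ (Set.range fun i => t i • (v i : E n)) =
      polarBody (⋂ i, halfSpace (t i)⁻¹ (v i)) := by
  have hQ : ∀ z : E n, z ∈ (⋂ i, halfSpace (t i)⁻¹ (v i)) ↔
      ∀ i, inner ℝ z (t i • (v i : E n)) ≤ 1 := by
    intro z
    rw [Set.mem_iInter]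
    refine forall_congr' fun i => ?_
    change inner ℝ z (v i : E n) ≤ (t i)⁻¹ ↔ _
    rw [real_inner_smul_right, ← mul_one (t i)⁻¹, le_inv_mul_iff₀ (ht i)]
  apply Set.Subset.antisymm
  · refine convexHull_min ?_ ?_
    · rintro _ ⟨i, rfl⟩ z hz
      exact (hQ z).1 hz i
    · intro x hx y hy a b ha hb hab z hz
      rw [inner_add_right, real_inner_smul_right, real_inner_smul_right]
      have h1 := mul_le_mul_of_nonneg_left (hx z hz) ha
      have h2 := mul_le_mul_of_nonneg_left (hy z hz) hb
      linarith
  · intro y hy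
    by_contra hnot
    obtain ⟨f, s, hf, hfy⟩ := geometric_hahn_banach_closed_point (convex_convexHull ℝ _)
      ((Set.finite_range fun i => t i • (v i : E n)).isCompact_convexHull (𝕜 := ℝ)).isClosed hnot
    obtain ⟨e, he⟩ : ∃ e : E n, ∀ x, inner ℝ e x = f x :=
      ⟨(InnerProductSpace.toDual ℝ (E n)).symm f, fun x => InnerProductSpace.toDual_symm_apply⟩
    have hx : ∀ i, inner ℝ e (t i • (v i : E n)) < s := fun i =>
      he _ ▸ hf _ (subset_convexHull ℝ _ ⟨i, rfl⟩)
    have he0 : e ≠ 0 := by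
      rintro rfl
      obtain ⟨i⟩ := ‹Nonempty (Fin m)›
      have h0 := hx i
      rw [inner_zero_left] at h0
      rw [← he, inner_zero_left] at hfy
      exact lt_asymm h0 hfy
    obtain ⟨i, hi⟩ := hv e he0
    -- Since `e` is positive on some `v i`, the separating level can be normalized to 1.
    have hs : 0 < s := by
      refine lt_trans ?_ (hx i)
      rw [real_inner_smul_right, real_inner_comm]
      exact mul_pos (ht i) hi
    have hz : s⁻¹ • e ∈ ⋂ i, halfSpace (t i)⁻¹ (v i) := (hQ _).2 fun i => by
      rw [real_inner_smul_left, inv_mul_le_iff₀ hs, mul_one]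
      exact (hx i).le
    have := hy _ hz
    rw [real_inner_smul_left, inv_mul_le_iff₀ hs, mul_one, he] at this
    linarith

/-- Compactness of the sphere makes positivity uniform. This bounds the intersection of half-spaces,
so that its polar contains a ball. -/
theorem exists_pos_mul_norm_le_inner {n m : ℕ} [Nonempty (Fin m)] (v : Fin m → S n)
    (hv : ∀ e : E n, e ≠ 0 → ∃ i, 0 < inner ℝ (v i : E n) e) :
    ∃ δ : ℝ, 0 < δ ∧ ∀ z : E n, ∃ i, δ * ‖z‖ ≤ inner ℝ (v i : E n) z := by
  let F : E n → ℝ := fun e =>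
    Finset.univ.sup' Finset.univ_nonempty fun i => inner ℝ (v i : E n) e
  have hF : Continuous F := Continuous.finset_sup'_apply _ fun i _ => by fun_prop
  have hne : (Metric.sphere (0 : E n) 1).Nonempty := by
    obtain ⟨i⟩ := ‹Nonempty (Fin m)›
    exact ⟨_, (v i).2⟩
  obtain ⟨e, he, hmin⟩ := (isCompact_sphere (0 : E n) 1).exists_isMinOn hne hF.continuousOn
  have he1 : ‖e‖ = 1 := by simpa using he
  refine ⟨F e, ?_, fun z => ?_⟩
  · obtain ⟨i, hi⟩ := hv e (norm_ne_zero_iff.1 (he1 ▸ one_ne_zero))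
    exact hi.trans_le (Finset.le_sup' (fun i => inner ℝ (v i : E n) e) (Finset.mem_univ i))
  · by_cases hz : z = 0
    · exact ⟨Classical.arbitrary _, by simp [hz]⟩
    · have hn : 0 < ‖z‖ := norm_pos_iff.2 hz
      obtain ⟨i, -, hi⟩ := Finset.exists_mem_eq_sup' Finset.univ_nonempty
        fun i => inner ℝ (v i : E n) (‖z‖⁻¹ • z)
      have h : F e ≤ inner ℝ (v i : E n) (‖z‖⁻¹ • z) :=
        (isMinOn_iff.1 hmin _ (by simp [norm_smul, hn.ne'])).trans hi.le
      rw [real_inner_smul_right, le_inv_mul_iff₀ hn, mul_comm] at h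
      exact ⟨i, h⟩

theorem zero_mem_interior_polarBody {n m : ℕ} [Nonempty (Fin m)] (v : Fin m → S n) (α : Fin m → ℝ)
    (hα : ∀ i, 0 < α i) (hv : ∀ e : E n, e ≠ 0 → ∃ i, 0 < inner ℝ (v i : E n) e) :
    (0 : E n) ∈ interior (polarBody (⋂ i, halfSpace (α i) (v i))) := by
  obtain ⟨δ, hδ, hδv⟩ := exists_pos_mul_norm_le_inner v hv
  have hA : 0 < ∑ i, α i := Finset.sum_pos (fun i _ => hα i) Finset.univ_nonempty
  -- The sum of the `α i` is a crude bound for each of them: every `z` in the intersection has `δ *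
  -- ‖z‖ ≤ ∑ i, α i`.
  refine mem_interior.2 ⟨Metric.ball 0 (δ / ∑ i, α i), fun y hy z hz => ?_, Metric.isOpen_ball,
    Metric.mem_ball_self (div_pos hδ hA)⟩
  rw [mem_ball_zero_iff, lt_div_iff₀ hA] at hy
  obtain ⟨i, hi⟩ := hδv z
  have hzi : inner ℝ z (v i : E n) ≤ α i := Set.mem_iInter.1 hz i
  rw [real_inner_comm] at hzi
  have hαA : α i ≤ ∑ i, α i := Finset.single_le_sum (fun i _ => (hα i).le) (Finset.mem_univ i)
  have hz' : δ * ‖z‖ ≤ ∑ i, α i := hi.trans (hzi.trans hαA)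
  refine (real_inner_le_norm z y).trans ?_
  have h : δ * (‖z‖ * ‖y‖) ≤ δ * 1 := by
    calc δ * (‖z‖ * ‖y‖) = δ * ‖z‖ * ‖y‖ := by ring
      _ ≤ (∑ i, α i) * ‖y‖ := mul_le_mul_of_nonneg_right hz' (norm_nonneg y)
      _ ≤ δ * 1 := by rw [mul_comm, mul_one]; exact hy.le
  exact le_of_mul_le_mul_left h hδ

theorem radialMap_mem {n : ℕ} {K : Set (E n)} (hK : K ∈ convexBodiesO n) (e : S n) :
    0 ≤ radialFunction K e ∧ radialMap K e ∈ K := by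
  obtain ⟨hc, -, h0⟩ := hK
  let A : Set ℝ := {a : ℝ | a • (e : E n) ∈ K}
  have h0A : (0 : ℝ) ∈ A := by
    change (0 : ℝ) • (e : E n) ∈ K
    rw [zero_smul]
    exact interior_subset h0
  have hbdd : BddAbove A := by
    obtain ⟨R, hR⟩ := hc.isBounded.exists_norm_le
    refine ⟨R, fun a ha => ?_⟩
    have := hR _ ha
    rw [norm_smul, norm_sphere, mul_one] at this
    exact (le_abs_self a).trans this
  have hcl : IsClosed A := hc.isClosed.preimage (by fun_prop : Continuous fun a : ℝ => a • (e : E n))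
  exact ⟨le_csSup hbdd h0A, hcl.csSup_mem ⟨0, h0A⟩ hbdd⟩

theorem smul_sphere_injective {n : ℕ} {a b : ℝ} (ha : 0 ≤ a) (hb : 0 < b) {e e' : S n}
    (h : a • (e : E n) = b • (e' : E n)) : e = e' := by
  have hn := congrArg norm h
  rw [norm_smul, norm_smul, norm_sphere, norm_sphere, mul_one, mul_one, Real.norm_of_nonneg ha,
    Real.norm_of_nonneg hb.le] at hn
  subst hn
  exact Subtype.ext (smul_right_injective (E n) hb.ne' h)

end GaussImage

/-! ### The polytope and its Gauss image measure -/

open GaussImage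

theorem mainTheorem3 (n m k : ℕ) (hn : 1 ≤ n)
    (v : Fin m → GaussImage.S n) (w : Fin m → ℕ) (u : Fin k → GaussImage.S n)
    (hv : Function.Injective v) (hw : ∀ i, 0 < w i) (hu : Function.Injective u)
    (mu lam : Measure (GaussImage.S n))
    (hmu : mu = GaussImage.discreteMeasure (fun i => (w i : ℝ≥0∞)) v)
    (hlam : lam = GaussImage.discreteMeasure (fun _ => 1) u)
    (hrel : GaussImage.WeakAleksandrovRelated mu lam)
    (hloop : GaussImage.EdgeNormalLoopFree u v)
    (hhemi : ¬ GaussImage.ConcentratedOnClosedHemisphere mu) :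
    ∃ P ∈ GaussImage.polytopeClass v,
      Set.extremePoints ℝ P = Set.range (fun i => GaussImage.radialMap P (v i)) ∧
      ∀ ω : Set (GaussImage.S n), MeasurableSet ω →
        GaussImage.gaussImageMeasure lam P ω = mu ω := by
  subst hmu hlam
  have hpos : ∀ e : E n, e ≠ 0 → ∃ i, 0 < inner ℝ (v i : E n) e := fun e he =>
    exists_inner_pos v _ hhemi he
  have : Nonempty (Fin m) := by
    have : Nonempty (Fin n) := ⟨⟨0, hn⟩⟩
    obtain ⟨e, he⟩ := exists_ne (0 : E n)
    exact (hpos e he).nonempty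
  obtain ⟨e, t, ht, hept, hmax⟩ := exists_strict_assignment v w u hw hrel hv hu hloop
  obtain ⟨x, hx⟩ : ∃ x : Fin m → E n, x = fun i => t i • (v i : E n) := ⟨_, rfl⟩
  have hxi : ∀ i, x i = t i • (v i : E n) := fun i => congrFun hx i
  obtain ⟨P, hP⟩ : ∃ P, P = convexHull ℝ (Set.range x) := ⟨_, rfl⟩
  have hPpolar : P = polarBody (⋂ i, halfSpace (t i)⁻¹ (v i)) := by
    rw [hP, hx]
    exact convexHull_eq_polarBody v t ht hpos
  have hPK : P ∈ convexBodiesO n :=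
    ⟨hP ▸ (Set.finite_range x).isCompact_convexHull (𝕜 := ℝ), hP ▸ convex_convexHull ℝ _,
      hPpolar ▸ zero_mem_interior_polarBody v _ (fun i => inv_pos.2 (ht i)) hpos⟩
  have hxP : ∀ i, x i ∈ P := fun i => hP ▸ subset_convexHull ℝ _ ⟨i, rfl⟩
  have hsupp : ∀ j, ∀ y ∈ P, y = x (e j).1 ∨
      inner ℝ (u j : E n) y < inner ℝ (u j : E n) (x (e j).1) := fun j y hy =>
    eq_or_inner_lt_of_mem_convexHull x _ _ (fun i hi => by
      rw [hxi, hxi]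
      exact hmax j i hi) (hP ▸ hy)
  have hle : ∀ j, ∀ y ∈ P, inner ℝ (u j : E n) y ≤ inner ℝ (u j : E n) (x (e j).1) := by
    intro j y hy
    rcases hsupp j y hy with rfl | h
    exacts [le_rfl, h.le]
  -- Positive weights give each `x i` some `u j` exposing it.
  have hsurj : ∀ i, ∃ j, (e j).1 = i := fun i => ⟨e.symm ⟨i, ⟨0, hw i⟩⟩, by simp⟩
  have hrad : ∀ i, radialMap P (v i) = x i := by
    intro i
    obtain ⟨j, rfl⟩ := hsurj i
    rw [hxi]
    refine congrArg (· • (v (e j).1 : E n)) (IsGreatest.csSup_eq ⟨?_, fun a ha => ?_⟩)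
    · have h := hxP (e j).1
      rwa [hxi] at h
    · have h := hle j _ ha
      rw [hxi, real_inner_smul_right, real_inner_smul_right] at h
      exact le_of_mul_le_mul_right h (hept j)
  refine ⟨P, ⟨hPK, ⟨_, Set.finite_range x, hP⟩, _, fun i => inv_pos.2 (ht i), hPpolar⟩, ?_, ?_⟩
  · simp only [hrad]
    apply Set.Subset.antisymm
    · rw [hP]
      exact extremePoints_convexHull_subset
    · rintro _ ⟨i, rfl⟩
      obtain ⟨j, rfl⟩ := hsurj i
      refine ⟨hxP _, fun y hy z hz hyz => ?_⟩
      obtain ⟨a, b, ha, hb, hab, h⟩ := hyz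
      refine (hsupp j y hy).resolve_right fun hlt => ?_
      have h1 := congrArg (inner ℝ (u j : E n)) h
      rw [inner_add_right, real_inner_smul_right, real_inner_smul_right] at h1
      have h2 := mul_lt_mul_of_pos_left hlt ha
      have h3 := mul_le_mul_of_nonneg_left (hle j z hz) hb.le
      have h4 : inner ℝ (u j : E n) (x (e j).1) = a * inner ℝ (u j : E n) (x (e j).1) +
          b * inner ℝ (u j : E n) (x (e j).1) := by rw [← add_mul, hab, one_mul]
      linarith
  · intro ω _
    -- The only point of `P` with `u j` as a normal is `x (e j).1`, and the ray through it
    -- determines the direction.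
    have hiff : ∀ j, u j ∈ radialGaussImage P ω ↔ v (e j).1 ∈ ω := by
      intro j
      simp only [radialGaussImage, Set.mem_iUnion, Set.mem_image, exists_prop]
      constructor
      · rintro ⟨_, ⟨d, hd, rfl⟩, hnorm⟩
        obtain ⟨h0, hmem⟩ := radialMap_mem hPK d
        have h1 := hnorm _ (hxP (e j).1)
        rw [inner_sub_left, real_inner_comm, real_inner_comm (u j : E n)] at h1
        have h2 : radialMap P d = x (e j).1 :=
          (hsupp j _ hmem).resolve_right fun hlt => by linarith
        rw [hxi] at h2
        exact smul_sphere_injective h0 (ht _) h2 ▸ hd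
      · intro hω
        refine ⟨_, ⟨_, hω, rfl⟩, fun y hy => ?_⟩
        rw [hrad, inner_sub_left, real_inner_comm, real_inner_comm (u j : E n)]
        linarith [hle j y hy]
    have hind : ∀ j, (radialGaussImage P ω).indicator (1 : S n → ℝ≥0∞) (u j) =
        ω.indicator 1 (v (e j).1) := by
      intro j
      by_cases h : v (e j).1 ∈ ω
      · rw [Set.indicator_of_mem h, Set.indicator_of_mem ((hiff j).2 h)]
        rfl
      · rw [Set.indicator_of_notMem h, Set.indicator_of_notMem (mt (hiff j).1 h)]
    simp only [gaussImageMeasure, discreteMeasure_apply, one_mul, hind]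
    -- Reindexing by slots counts each `v i` in `ω` exactly `w i` times.
    rw [Equiv.sum_comp e (fun q => ω.indicator (1 : S n → ℝ≥0∞) (v q.1)), Fintype.sum_sigma]
    simp
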